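/- Let $k,q\ge 1$ be integers. Let $W_{k,q}=\{\mathbf v\in\mathbb Z^{k-1}: 0\le v_1\le v_2\le\cdots\le v_{k-1}\le q\}$, and let $T_{k,q}$ (the edgewise subdivision of the $(k-1)$-simplex $\{\mathbf x\in\mathbb R^{k-1}:0\le x_1\le\cdots\le x_{k-1}\le q\}$) be the simplicial complex with vertex set $W_{k,q}$ whose facets are the sets $$F(\mathbf v,\pi)=\{\mathbf v,\ \mathbf v+e_{\pi_{k-1}},\ \mathbf v+e_{\pi_{k-1}}+e_{\pi_{k-2}},\ \dots,\ \mathbf v+e_{\pi_{k-1}}+\cdots+e_{\pi_1}=\mathbf v+\mathbb 1\},$$ where $\mathbf v$ and $\mathbf v+\mathbb 1$ belong to $W_{k,q}$ and $\pi=\pi_1\cdots\pi_{k-1}$ is a permutation of $\{1,\dots,k-1\}$ in which $i$ stands before $i+1$ whenever $v_i=v_{i+1}$. The link of a vertex $\mathbf v$ of a complex $T$ is $\{\tau\in T:\mathbf v\notin\tau,\ \tau\cup\{\mathbf v\}\in T\}$, and two complexes are combinatorially equivalent if some bijection of their vertex sets carries the faces of one exactly onto the faces of the other. For $s\ge1$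 let $\mathrm{Par}(k,s)$ be the set of partitions of $k$ into exactly $s$ parts, $p_{k,s}=|\mathrm{Par}(k,s)|$, and let $p_k$ be the number of all partitions of $k$. For a partition $\lambda=(\lambda_1\ge\cdots\ge\lambda_s)$ of $k$ let $P_\lambda=C_{\lambda_1}\times\cdots\times C_{\lambda_s}$, where $C_m$ is the chain $0<1<\cdots<m$, and let $K_\lambda$ be the reduced order complex of $P_\lambda$, that is, the complex of all finite chains of $P_\lambda\setminus\{\hat 0,\hat 1\}$. Then, up to combinatorial equivalence, the links of the vertices of $T_{k,q}$ are exactly the complexes $K_\lambda$ with $\lambda\in\bigcup_{s=1}^{q}\mathrm{Par}(k,s)$: the link of every vertex is combinatorially equivalent to such a $K_\lambda$, and every such $K_\lambda$ is combinatorially equivalent to the link of some vertex. Moreover, the number of combinatorially different links of vertices of $T_{k,q}$ is $p_k$ if $q\ge k$, and $p_{k,1}+p_{k,2}+\cdots+p_{k,q}$ if $q<k$. -/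

import Mathlib

namespace PreAbstractSimplicialComplex

/-- The vertex set of a simplicial complex: the points that are faces. -/
def vertices {α : Type*} (K : PreAbstractSimplicialComplex α) : Set α :=
  {a | {a} ∈ K.faces}

/-- The link of `σ` in `K`: the faces `τ` that are disjoint from `σ` and such that `σ ∪ τ` is
again a face. (Only nonempty faces are listed, as everywhere in Mathlib.) -/
def link {α : Type*} [DecidableEq α] (K : PreAbstractSimplicialComplex α) (σ : Finset α) :
    PreAbstractSimplicialComplex α where
  faces := {τ | τ ∈ K.faces ∧ σ ∪ τ ∈ K.faces ∧ Disjoint σ τ}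
  isRelLowerSet_faces := by
    rintro τ ⟨h1, h2, h3⟩
    refine ⟨(K.isRelLowerSet_faces h1).1, fun ρ hρ hne => ⟨?_, ?_, ?_⟩⟩
    · exact (K.isRelLowerSet_faces h1).2 hρ hne
    · exact (K.isRelLowerSet_faces h2).2 (Finset.union_subset_union_right hρ)
        (hne.mono Finset.subset_union_right)
    · exact h3.mono_right hρ

/-- Combinatorial equivalence of simplicial complexes: a bijection between the vertex sets under
which faces correspond to faces, in both directions. -/
def Iso {α β : Type*} (K : PreAbstractSimplicialComplex α) (L : PreAbstractSimplicialComplex β) :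
    Prop :=
  ∃ f : K.vertices ≃ L.vertices, ∀ s : Finset K.vertices,
    s.map (Function.Embedding.subtype _) ∈ K.faces ↔
      (s.map f.toEmbedding).map (Function.Embedding.subtype _) ∈ L.faces

theorem Iso.refl {α : Type*} (K : PreAbstractSimplicialComplex α) : K.Iso K :=
  ⟨Equiv.refl _, fun s => by simp⟩

theorem Iso.symm {α β : Type*} {K : PreAbstractSimplicialComplex α}
    {L : PreAbstractSimplicialComplex β} (h : K.Iso L) : L.Iso K := by
  obtain ⟨f, hf⟩ := h
  refine ⟨f.symm, fun s => ?_⟩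
  have h1 := hf (s.map f.symm.toEmbedding)
  rw [h1, Finset.map_map (f := f.symm.toEmbedding)]
  have h2 : f.symm.toEmbedding.trans f.toEmbedding = Function.Embedding.refl _ := by
    ext x; simp
  rw [h2, Finset.map_refl]

theorem Iso.trans {α β γ : Type*} {K : PreAbstractSimplicialComplex α}
    {L : PreAbstractSimplicialComplex β} {M : PreAbstractSimplicialComplex γ}
    (h : K.Iso L) (h' : L.Iso M) : K.Iso M := by
  obtain ⟨f, hf⟩ := h
  obtain ⟨g, hg⟩ := h'
  refine ⟨f.trans g, fun s => ?_⟩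
  rw [hf s, hg (s.map f.toEmbedding), Finset.map_map (f := f.toEmbedding)]
  rfl

/-- Combinatorial equivalence as an equivalence relation; its classes are the combinatorial types
of complexes. -/
def isoSetoid (α : Type*) : Setoid (PreAbstractSimplicialComplex α) where
  r := Iso
  iseqv := ⟨Iso.refl, Iso.symm, Iso.trans⟩

end PreAbstractSimplicialComplex

namespace EdgewiseSubdivision

/-- The integer points `0 ≤ v₁ ≤ ⋯ ≤ v_{k-1} ≤ q` of the simplex `R_{k,q}`. -/
def W (k q : ℕ) : Set (Fin (k - 1) → ℤ) :=
  {v | (∀ i, 0 ≤ v i ∧ v i ≤ (q : ℤ)) ∧ Monotone v}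

/-- The permutation `π = π₁ ⋯ π_{k-1}` is consistent with `v`: `i` stands before `i + 1` in `π`
whenever `v i = v (i + 1)`. (The position of `i` in `π` is `π.symm i`.) -/
def Consistent {k : ℕ} (v : Fin (k - 1) → ℤ) (π : Equiv.Perm (Fin (k - 1))) : Prop :=
  ∀ i j : Fin (k - 1), (j : ℕ) = i + 1 → v i = v j → π.symm i < π.symm j

/-- The vertex obtained from `v` by adding `1` to the coordinates that stand in the last `j`
positions of `π`: the point `v + e_{π_{k-1}} + ⋯ + e_{π_{k-j}}`. -/
def facetVertex {k : ℕ} (v : Fin (k - 1) → ℤ) (π : Equiv.Perm (Fin (k - 1))) (j : ℕ) :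
    Fin (k - 1) → ℤ :=
  fun i => v i + if k - 1 ≤ (π.symm i : ℕ) + j then 1 else 0

/-- The vertex set of the facet `F(v, π)`. -/
def facet {k : ℕ} (v : Fin (k - 1) → ℤ) (π : Equiv.Perm (Fin (k - 1))) :
    Finset (Fin (k - 1) → ℤ) :=
  (Finset.range k).image (facetVertex v π)

/-- The edgewise subdivision `T_{k,q}` of the simplex `R_{k,q}`, as an abstract simplicial
complex: its faces are the nonempty subsets of the facets `F(v, π)`, where `v` and `v + 𝟙` (the
first and the last vertex of the facet) lie in `R_{k,q}` and `π` is consistent with `v`. -/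
def T (k q : ℕ) : PreAbstractSimplicialComplex (Fin (k - 1) → ℤ) where
  faces := {s | s.Nonempty ∧ ∃ (v : Fin (k - 1) → ℤ) (π : Equiv.Perm (Fin (k - 1))),
    v ∈ W k q ∧ v + 1 ∈ W k q ∧ Consistent v π ∧ s ⊆ facet v π}
  isRelLowerSet_faces := by
    rintro s ⟨hs, v, π, h1, h2, h3, h4⟩
    exact ⟨hs, fun t ht hne => ⟨hne, v, π, h1, h2, h3, ht.trans h4⟩⟩

/-- The vertex set of `T_{k,q}` is `W_{k,q}`. -/
theorem vertices_T {k q : ℕ} (hk : 1 ≤ k) (hq : 1 ≤ q) : (T k q).vertices = W k q := by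
  ext v
  constructor
  · rintro ⟨-, u, π, ⟨hu, hm⟩, ⟨hu', -⟩, hc, hs⟩
    rw [Finset.singleton_subset_iff, facet, Finset.mem_image] at hs
    obtain ⟨j, -, rfl⟩ := hs
    refine ⟨fun i => ?_, ?_⟩
    · have h1 := hu i
      have h2 := hu' i
      simp only [Pi.add_apply, Pi.one_apply] at h2
      unfold facetVertex
      split_ifs <;> omega
    · have key : ∀ n : ℕ, ∀ a b : Fin (k - 1), (b : ℕ) = a + n →
          facetVertex u π j a ≤ facetVertex u π j b := by
        intro n
        induction n with
        | zero =>
          intro a b hab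
          have : a = b := Fin.ext (by omega)
          rw [this]
        | succ n ih =>
          intro a b hab
          have hlt : (a : ℕ) + n < k - 1 := by have := b.2; omega
          refine (ih a ⟨a + n, hlt⟩ rfl).trans ?_
          have h1 : u ⟨a + n, hlt⟩ ≤ u b := hm (Fin.mk_le_of_le_val (by omega))
          have h2 := hc ⟨a + n, hlt⟩ b (by simp; omega)
          unfold facetVertex
          rcases h1.lt_or_eq with h | h
          · split_ifs <;> omega
          · have h3 : (π.symm ⟨a + n, hlt⟩ : ℕ) < π.symm b := h2 h
            split_ifs <;> omega
      intro a b hab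
      exact key (b - a) a b (by have : (a : ℕ) ≤ b := hab; omega)
  · rintro ⟨hv, hm⟩
    have hj : ∃ j, j < k ∧ ∀ i : Fin (k - 1), v i = (q : ℤ) ↔ k - 1 ≤ (i : ℕ) + j := by
      by_cases he : ∃ i, v i = (q : ℤ)
      · obtain ⟨i, hi, hmin⟩ := WellFounded.has_min wellFounded_lt {i | v i = (q : ℤ)} he
        refine ⟨k - 1 - i, by omega, fun a => ⟨fun ha => ?_, fun ha => ?_⟩⟩
        · have : ¬ a < i := hmin a ha
          have : (i : ℕ) ≤ a := not_lt.mp this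
          omega
        · have h1 : i ≤ a := Fin.le_def.mpr (by have := i.2; omega)
          have h2 := hm h1
          have h3 := (hv a).2
          have h4 : v i = (q : ℤ) := hi
          omega
      · push Not at he
        exact ⟨0, by omega, fun a => ⟨fun ha => (he a ha).elim, fun ha => by
          have := a.2; omega⟩⟩
    obtain ⟨j, hjk, hj⟩ := hj
    refine ⟨Finset.singleton_nonempty _, fun i => v i - if v i = (q : ℤ) then 1 else 0, 1,
      ⟨fun i => ?_, fun a b hab => ?_⟩, ⟨fun i => ?_, fun a b hab => ?_⟩, ?_, ?_⟩
    · have := hv i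
      dsimp only
      split_ifs <;> omega
    · have h1 := hm hab
      have h2 := hv b
      dsimp only
      split_ifs <;> omega
    · have := hv i
      simp only [Pi.add_apply, Pi.one_apply]
      split_ifs <;> omega
    · have h1 := hm hab
      have h2 := hv b
      simp only [Pi.add_apply, Pi.one_apply]
      split_ifs <;> omega
    · intro a b hab _
      show a < b
      exact Fin.lt_def.mpr (by omega)
    · rw [Finset.singleton_subset_iff, facet, Finset.mem_image]
      refine ⟨j, Finset.mem_range.mpr hjk, ?_⟩
      funext i
      have h1 := hj i
      have h2 : (((1 : Equiv.Perm (Fin (k - 1))).symm i : Fin (k - 1)) : ℕ) = i := rfl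
      unfold facetVertex
      rw [h2]
      beta_reduce
      by_cases h : v i = (q : ℤ)
      · rw [if_pos h, if_pos (h1.mp h)]; ring
      · rw [if_neg h, if_neg (fun h' => h (h1.mpr h'))]; ring

/-- The order complex of a partially ordered set: its faces are the nonempty finite chains. -/
def orderComplex (P : Type*) [PartialOrder P] : PreAbstractSimplicialComplex P where
  faces := {s | s.Nonempty ∧ IsChain (· ≤ ·) (s : Set P)}
  isRelLowerSet_faces := by
    rintro s ⟨hs, hc⟩
    exact ⟨hs, fun t ht hne => ⟨hne, hc.mono (Finset.coe_subset.mpr ht)⟩⟩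

/-- A bounded partially ordered set without its minimum and its maximum. -/
abbrev Proper (P : Type*) [PartialOrder P] [BoundedOrder P] : Type _ :=
  {x : P // x ≠ ⊥ ∧ x ≠ ⊤}

/-- The product `C_{m₁} × ⋯ × C_{mₛ}` of chains, where `C_m = {0 < 1 < ⋯ < m}` is the chain of
length `m`, with the componentwise order. -/
abbrev ProductOfChains (m : List ℕ) : Type :=
  ∀ i : Fin m.length, Fin (m.get i + 1)

/-- The parts `λ₁ ≥ λ₂ ≥ ⋯ ≥ λₛ` of a partition in decreasing order. -/
def sortedParts {k : ℕ} (p : k.Partition) : List ℕ :=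
  p.parts.sort (· ≥ ·)

/-- The complex `K_λ` of a partition `λ = (λ₁, …, λₛ)`: the reduced order complex of
`C_{λ₁} × ⋯ × C_{λₛ}`. -/
def K {k : ℕ} (p : k.Partition) :
    PreAbstractSimplicialComplex (Proper (ProductOfChains (sortedParts p))) :=
  orderComplex _

/-- `Par(k, s)`: the partitions of `k` into exactly `s` parts. -/
def Par (k s : ℕ) : Set k.Partition :=
  {p | p.parts.card = s}

/-- The number of combinatorially different links of vertices of `T_{k,q}`. -/
noncomputable def numLinkTypes (k q : ℕ) : ℕ :=
  ((fun v => (Quotient.mk (PreAbstractSimplicialComplex.isoSetoid _) ((T k q).link {v}))) ''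
    (T k q).vertices).ncard

end EdgewiseSubdivision

/-!
Consistency of `π` with `v` means that the facets are exactly the maximal cliques of lattice points
of the simplex any two of which are comparable vertices of a common unit cube, so the subdivision is
a clique complex and the link of `v` is the clique complex on the neighbours of `v`.

Read cyclically, `0 ≤ v₁ ≤ ⋯ ≤ v_{k-1} ≤ q` is a chain of inequalities among `k` coordinates, one of
which is the constant `0 ≡ q`. Moving to a neighbour of `v` amounts to lowering a nonempty proper
set of these coordinates, and the result stays in the simplex if and only if that set is a lower set
for the inequalities that are tight at `v`. The tight inequalities order the coordinates as a
disjoint union of chains, whose sizes form a partition `λ` of `k`; the lattice of lower sets of this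
union is the product of chains `P_λ`, and the link is its reduced order complex. Every partition
with at most `q` parts arises, as its chains are the nonempty classes of coordinates modulo `q`.

Conversely, the comparability graph of the proper part of `P_λ` determines that of `P_λ`, and hence
the numbers of its multichains of size `n`, which are `∏ᵢ (λᵢ + n).choose n`. The quotients of
consecutive products are essentially the values of the polynomial `∏ᵢ (X + λᵢ)`, which recovers `λ`.
-/

namespace EdgewiseSubdivision

open PreAbstractSimplicialComplex Relation
open scoped Function

section CliqueComplex

variable {α β : Type*} {V : Set α} {V' : Set β} {r : α → α → Prop} {r' : β → β → Prop}

/-- The clique complex of the graph on the vertex set `V` whose edges join the distinct points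
related by `r`: its faces are the nonempty finite sets of pairwise related points of `V`. -/
def cliqueComplex (V : Set α) (r : α → α → Prop) : PreAbstractSimplicialComplex α where
  faces := {s | s.Nonempty ∧ (s : Set α) ⊆ V ∧ (s : Set α).Pairwise r}
  isRelLowerSet_faces := fun _ hs => ⟨hs.1, fun _ hts ht =>
    ⟨ht, (Finset.coe_subset.mpr hts).trans hs.2.1, hs.2.2.mono (Finset.coe_subset.mpr hts)⟩⟩

theorem mem_cliqueComplex {s : Finset α} :
    s ∈ (cliqueComplex V r).faces ↔
      s.Nonempty ∧ (s : Set α) ⊆ V ∧ (s : Set α).Pairwise r :=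
  Iff.rfl

theorem vertices_cliqueComplex (V : Set α) (r : α → α → Prop) :
    (cliqueComplex V r).vertices = V := by
  ext x
  simp [vertices, mem_cliqueComplex]

theorem link_cliqueComplex [DecidableEq α] [Std.Symm r] {v : α} (hv : v ∈ V) :
    (cliqueComplex V r).link {v} = cliqueComplex {w | w ∈ V ∧ w ≠ v ∧ r v w} r := by
  ext s
  change s ∈ (cliqueComplex V r).faces ∧ {v} ∪ s ∈ (cliqueComplex V r).faces ∧ Disjoint {v} s ↔ _
  simp only [mem_cliqueComplex, Finset.coe_union, Finset.coe_singleton, Set.singleton_union,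
    Set.insert_subset_iff, Set.pairwise_insert_of_symm, Finset.disjoint_singleton_left]
  constructor
  · rintro ⟨⟨hne, hsV, hs⟩, ⟨-, -, -, hvs⟩, hv'⟩
    have ne_v : ∀ w ∈ s, w ≠ v := fun w hw h => hv' (h ▸ hw)
    exact ⟨hne, fun w hw => ⟨hsV hw, ne_v w hw, hvs w hw (ne_v w hw).symm⟩, hs⟩
  · rintro ⟨hne, hsV, hs⟩
    exact ⟨⟨hne, fun w hw => (hsV hw).1, hs⟩,
      ⟨by simp, ⟨hv, fun w hw => (hsV hw).1⟩, hs, fun w hw _ => (hsV hw).2.2⟩,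
      fun h => (hsV h).2.1 rfl⟩

theorem map_subtype_mem_cliqueComplex (t : Finset (cliqueComplex V r).vertices) :
    t.map (Function.Embedding.subtype _) ∈ (cliqueComplex V r).faces ↔
      t.Nonempty ∧ (t : Set (cliqueComplex V r).vertices).Pairwise (r on Subtype.val) := by
  have subset_V : Subtype.val '' (t : Set (cliqueComplex V r).vertices) ⊆ V := by
    rintro _ ⟨x, -, rfl⟩
    exact (vertices_cliqueComplex V r).subset x.2
  simp [mem_cliqueComplex, subset_V, Set.InjOn.pairwise_image Subtype.val_injective.injOn]

theorem cliqueComplex_iso_iff [Std.Symm r] [Std.Symm r'] :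
    (cliqueComplex V r).Iso (cliqueComplex V' r') ↔
      ∃ e : V ≃ V', ∀ x y : V, x ≠ y → (r x y ↔ r' (e x) (e y)) := by
  classical
  let toV := Equiv.setCongr (vertices_cliqueComplex V r)
  let toV' := Equiv.setCongr (vertices_cliqueComplex V' r')
  constructor
  · rintro ⟨f, hf⟩
    refine ⟨toV.symm.trans (f.trans toV'), fun x y hxy => ?_⟩
    have pair := hf {toV.symm x, toV.symm y}
    rw [map_subtype_mem_cliqueComplex, map_subtype_mem_cliqueComplex] at pair
    simp only [Finset.map_nonempty, Finset.insert_nonempty, Finset.coe_map, Finset.coe_insert,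
      Finset.coe_singleton, Set.image_pair, Set.pairwise_pair_of_symm, Equiv.coe_toEmbedding,
      ne_eq, EmbeddingLike.apply_eq_iff_eq, hxy, not_false_eq_true, true_and, forall_const] at pair
    exact pair
  · rintro ⟨e, he⟩
    refine ⟨toV.trans (e.trans toV'.symm), fun s => ?_⟩
    rw [map_subtype_mem_cliqueComplex, map_subtype_mem_cliqueComplex, Finset.map_nonempty,
      Finset.coe_map, Equiv.coe_toEmbedding, Set.InjOn.pairwise_image (Equiv.injective _).injOn]
    refine and_congr_right fun _ => forall₂_congr fun x _ => forall₂_congr fun y _ => ?_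
    exact forall_congr' fun hxy => he (toV x) (toV y) (toV.injective.ne hxy)

theorem orderComplex_eq_cliqueComplex (P : Type*) [PartialOrder P] :
    orderComplex P = cliqueComplex Set.univ (SymmGen (· ≤ ·)) := by
  ext s
  exact and_congr_right fun _ => (and_iff_right (Set.subset_univ _)).symm

theorem cliqueComplex_iso_orderComplex_iff [Std.Symm r] {P : Type*} [PartialOrder P] :
    (cliqueComplex V r).Iso (orderComplex P) ↔
      ∃ e : V ≃ P, ∀ x y : V, x ≠ y → (r x y ↔ SymmGen (· ≤ ·) (e x) (e y)) := by
  rw [orderComplex_eq_cliqueComplex, cliqueComplex_iso_iff]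
  exact ⟨fun ⟨e, he⟩ => ⟨e.trans (Equiv.Set.univ P), he⟩,
    fun ⟨e, he⟩ => ⟨e.trans (Equiv.Set.univ P).symm, he⟩⟩

variable {P Q : Type*} [PartialOrder P] [PartialOrder Q]

theorem orderComplex_iso_iff :
    (orderComplex P).Iso (orderComplex Q) ↔
      ∃ e : P ≃ Q, ∀ x y, SymmGen (· ≤ ·) x y ↔ SymmGen (· ≤ ·) (e x) (e y) := by
  rw [orderComplex_eq_cliqueComplex P, cliqueComplex_iso_orderComplex_iff]
  constructor
  · rintro ⟨e, he⟩
    refine ⟨(Equiv.Set.univ P).symm.trans e, fun x y => ?_⟩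
    obtain rfl | hxy := eq_or_ne x y
    · exact iff_of_true .rfl .rfl
    · exact he ⟨x, trivial⟩ ⟨y, trivial⟩ (mt (congrArg Subtype.val) hxy)
  · rintro ⟨e, he⟩
    exact ⟨(Equiv.Set.univ P).trans e, fun x y _ => he x y⟩

theorem orderComplex_proper_iso [BoundedOrder P] [BoundedOrder Q] (e : P ≃o Q) :
    (orderComplex (Proper P)).Iso (orderComplex (Proper Q)) := by
  refine orderComplex_iso_iff.mpr ⟨e.toEquiv.subtypeEquiv fun x => ?_, fun x y => ?_⟩
  · exact (and_congr (map_eq_bot_iff e).not (map_eq_top_iff e).not).symm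
  · exact (or_congr e.le_iff_le e.le_iff_le).symm

end CliqueComplex

section CubeAdj

variable {ι : Type*}

/-- Two integer points are cube-adjacent if they are comparable vertices of a common unit cube
of the lattice; distinct vertices of `T k q` form an edge exactly if they are cube-adjacent. -/
def CubeAdj : (ι → ℤ) → (ι → ℤ) → Prop :=
  SymmGen fun x y => y ∈ Set.Icc x (x + 1)

instance : Std.Symm (CubeAdj (ι := ι)) :=
  inferInstanceAs (Std.Symm (SymmGen _))

theorem cubeAdj_of_mem_Icc {v x y : ι → ℤ} (hx : x ∈ Set.Icc v (v + 1))
    (hy : y ∈ Set.Icc v (v + 1)) (hxy : SymmGen (· ≤ ·) x y) : CubeAdj x y :=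
  hxy.imp (fun h => ⟨h, hy.2.trans (add_le_add_left hx.1 1)⟩)
    fun h => ⟨h, hx.2.trans (add_le_add_left hy.1 1)⟩

theorem exists_least_of_pairwise_cubeAdj {s : Finset (ι → ℤ)} (hne : s.Nonempty)
    (hs : (s : Set (ι → ℤ)).Pairwise CubeAdj) : ∃ m ∈ s, (s : Set (ι → ℤ)) ⊆ Set.Icc m (m + 1) := by
  obtain ⟨m, hm, hmin⟩ := s.exists_minimal hne
  refine ⟨m, hm, fun x hx => ?_⟩
  obtain rfl | hne := eq_or_ne m x
  · exact ⟨le_rfl, le_add_of_nonneg_right zero_le_one⟩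
  obtain h | h := hs hm hx hne
  · exact h
  · exact absurd ((hmin hx h.1).antisymm h.1) hne

end CubeAdj

theorem exists_forall_mem_iff_val_lt {n : ℕ} {L : Set (Fin n)} (hL : IsLowerSet L) :
    ∃ t ≤ n, ∀ i, i ∈ L ↔ (i : ℕ) < t := by
  obtain rfl | ⟨a, rfl⟩ := hL.eq_univ_or_Iio
  · exact ⟨n, le_rfl, fun i => iff_of_true trivial i.2⟩
  · exact ⟨a, a.2.le, fun i => Iff.rfl⟩

section StableSort

variable {n : ℕ} {α : Type*} [LinearOrder α] {f : Fin n → α} {i j : Fin n}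

theorem sort_symm_lt_of_apply_lt (h : f i < f j) :
    (Tuple.sort f).symm i < (Tuple.sort f).symm j := by
  by_contra! hji
  exact h.not_ge (by simpa using Tuple.monotone_sort f hji)

theorem sort_symm_lt_of_apply_le (hij : i < j) (h : f i ≤ f j) :
    (Tuple.sort f).symm i < (Tuple.sort f).symm j := by
  obtain h | h := h.lt_or_eq
  · exact sort_symm_lt_of_apply_lt h
  by_contra! hji
  have stable := (Tuple.eq_sort_iff.mp (rfl : Tuple.sort f = Tuple.sort f)).2
  have hlt := hji.lt_of_ne ((Tuple.sort f).symm.injective.ne hij.ne')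
  exact hij.asymm (by simpa using stable _ _ hlt (by simpa using h.symm))

end StableSort

section Facets

variable {k q : ℕ} {v x : Fin (k - 1) → ℤ} {π : Equiv.Perm (Fin (k - 1))}

theorem facetVertex_mono (v : Fin (k - 1) → ℤ) (π : Equiv.Perm (Fin (k - 1))) :
    Monotone (facetVertex v π) := by
  intro a b hab i
  simp only [facetVertex]
  split_ifs <;> omega

theorem facetVertex_mem_Icc (v : Fin (k - 1) → ℤ) (π : Equiv.Perm (Fin (k - 1))) (j : ℕ) :
    facetVertex v π j ∈ Set.Icc v (v + 1) := by
  constructor <;> intro i <;> simp only [facetVertex, Pi.add_apply, Pi.one_apply] <;>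
    split_ifs <;> omega

theorem pairwise_cubeAdj_facet (v : Fin (k - 1) → ℤ) (π : Equiv.Perm (Fin (k - 1))) :
    (facet v π : Set (Fin (k - 1) → ℤ)).Pairwise CubeAdj := by
  intro x hx y hy _
  obtain ⟨a, -, rfl⟩ := Finset.mem_image.mp hx
  obtain ⟨b, -, rfl⟩ := Finset.mem_image.mp hy
  exact cubeAdj_of_mem_Icc (facetVertex_mem_Icc v π a) (facetVertex_mem_Icc v π b)
    ((le_total a b).imp (facetVertex_mono v π ·) (facetVertex_mono v π ·))

theorem mem_facet_of_forall (hk : 1 ≤ k) (hx : x ∈ Set.Icc v (v + 1))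
    (h : ∀ i j, π.symm i ≤ π.symm j → v i < x i → v j < x j) : x ∈ facet v π := by
  have lower : IsLowerSet {p | ¬ v (π p) < x (π p)} := fun p p' hp' hp hlt =>
    hp (h (π p') (π p) (by simpa using hp') hlt)
  obtain ⟨t, ht, raised⟩ := exists_forall_mem_iff_val_lt lower
  refine Finset.mem_image.mpr ⟨k - 1 - t, Finset.mem_range.mpr (by omega), funext fun i => ?_⟩
  have raised_i : ¬ v i < x i ↔ (π.symm i : ℕ) < t := by simpa using raised (π.symm i)
  have lower_i : v i ≤ x i := hx.1 i
  have upper_i : x i ≤ v i + 1 := hx.2 i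
  simp only [facetVertex]
  split_ifs <;> omega

/-- The permutation sorts the coordinates by the number of points of `s` in which they are
raised; stability of the sort makes it consistent. -/
theorem exists_consistent_subset_facet (hk : 1 ≤ k) {s : Finset (Fin (k - 1) → ℤ)}
    (hs : (s : Set (Fin (k - 1) → ℤ)) ⊆ Set.Icc v (v + 1)) (hmono : ∀ x ∈ s, Monotone x)
    (hchain : IsChain (· ≤ ·) (s : Set (Fin (k - 1) → ℤ))) :
    ∃ π, Consistent v π ∧ s ⊆ facet v π := by
  let level (i : Fin (k - 1)) : ℕ := (s.filter fun x => v i < x i).card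
  refine ⟨Tuple.sort level, fun i j hij hv => ?_, fun x hx => mem_facet_of_forall hk (hs hx) ?_⟩
  · have i_lt_j : i < j := Fin.lt_def.mpr (by omega)
    refine sort_symm_lt_of_apply_le i_lt_j (Finset.card_le_card fun x hx => ?_)
    rw [Finset.mem_filter] at hx ⊢
    exact ⟨hx.1, hv ▸ hx.2.trans_le (hmono x hx.1 i_lt_j.le)⟩
  · intro i j hij raised_i
    by_contra not_raised_j
    refine (sort_symm_lt_of_apply_lt (f := level) (Finset.card_lt_card ?_)).not_ge hij
    rw [Finset.ssubset_iff_of_subset]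
    · exact ⟨x, by simp [hx, raised_i], by simp [not_raised_j]⟩
    · intro y hy
      rw [Finset.mem_filter] at hy ⊢
      obtain h | h := hchain.total hx hy.1
      · exact ⟨hy.1, raised_i.trans_le (h i)⟩
      · exact absurd (hy.2.trans_le (h j)) not_raised_j

theorem exists_corner_mem_W (hq : 1 ≤ q) {m : Fin (k - 1) → ℤ} (hm : m ∈ W k q) :
    ∃ u ∈ W k q, u + 1 ∈ W k q ∧ W k q ∩ Set.Icc m (m + 1) ⊆ Set.Icc u (u + 1) := by
  have mono : Monotone fun i => min (m i) (q - 1) := hm.2.min monotone_const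
  have bounds := hm.1
  refine ⟨fun i => min (m i) (q - 1), ⟨fun i => ?_, mono⟩, ⟨fun i => ?_, mono.add_const 1⟩,
    fun x hx => ⟨fun i => ?_, fun i => ?_⟩⟩
  · grind
  · simp only [Pi.add_apply, Pi.one_apply]
    grind
  · have lower_i : m i ≤ x i := hx.2.1 i
    grind
  · have upper_i : x i ≤ m i + 1 := hx.2.2 i
    have := (hx.1.1 i).2
    simp only [Pi.add_apply, Pi.one_apply]
    grind

theorem T_eq_cliqueComplex (hk : 1 ≤ k) (hq : 1 ≤ q) :
    T k q = cliqueComplex (W k q) CubeAdj := by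
  ext s
  constructor
  · intro hs
    refine ⟨hs.1, fun x hx => ?_, ?_⟩
    · rw [← vertices_T hk hq]
      exact ((T k q).isRelLowerSet_faces hs).2 (Finset.singleton_subset_iff.mpr hx)
        (Finset.singleton_nonempty x)
    · obtain ⟨-, v, π, -, -, -, hsub⟩ := hs
      exact (pairwise_cubeAdj_facet v π).mono (Finset.coe_subset.mpr hsub)
  · rintro ⟨hne, hW, hadj⟩
    obtain ⟨m, hm, hm_least⟩ := exists_least_of_pairwise_cubeAdj hne hadj
    obtain ⟨u, hu, hu', h_corner⟩ := exists_corner_mem_W hq (hW hm)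
    obtain ⟨π, hπ, hsub⟩ := exists_consistent_subset_facet hk
      (fun x hx => h_corner ⟨hW hx, hm_least hx⟩) (fun x hx => (hW hx).2)
      fun x hx y hy hxy => (hadj hx hy hxy).imp And.left And.left
    exact ⟨hne, u, π, hu, hu', hπ, hsub⟩

end Facets

/-- The coordinates of a point `v` of the simplex `0 ≤ v₁ ≤ ⋯ ≤ vₙ ≤ q`, together with an
additional coordinate `base` that is `0` or, read cyclically, `q`. They are ordered by the tight
inequalities of the cyclic chain `base ≤ v₁ ≤ ⋯ ≤ vₙ ≤ base + q`. -/
inductive TightCoord {n : ℕ} (q : ℕ) (v : Fin n → ℤ) : Type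
  | base : TightCoord q v
  | coord (i : Fin n) : TightCoord q v

namespace TightCoord

variable {n q : ℕ} {v w : Fin n → ℤ}

/-- The numbering of the coordinates in which `base` comes first. -/
def equivFin (q : ℕ) (v : Fin n → ℤ) : TightCoord q v ≃ Fin (n + 1) where
  toFun
    | base => 0
    | coord i => i.succ
  invFun := Fin.cases base coord
  left_inv e := by cases e <;> rfl
  right_inv i := by cases i using Fin.cases <;> rfl

instance : Fintype (TightCoord q v) :=
  Fintype.ofEquiv _ (equivFin q v).symm

instance : Nonempty (TightCoord q v) :=
  ⟨base⟩

theorem card_tightCoord (q : ℕ) (v : Fin n → ℤ) : Fintype.card (TightCoord q v) = n + 1 := by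
  simp [Fintype.card_congr (equivFin q v)]

/-- The value of a coordinate modulo `q`. -/
def residue : TightCoord q v → ℤ
  | base => 0
  | coord i => if v i = q then 0 else v i

/-- The position of a coordinate in the cyclic order, cut before the first coordinate of
value `q`. -/
def position : TightCoord q v → ℤ
  | base => 0
  | coord i => if v i = q then i - n else i + 1

theorem position_injective : Function.Injective (position (q := q) (v := v)) := by
  rintro (_ | i) (_ | j) h <;> grind [position]

instance : PartialOrder (TightCoord q v) where
  le e e' := e.residue = e'.residue ∧ e.position ≤ e'.position
  le_refl _ := ⟨rfl, le_rfl⟩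
  le_trans _ _ _ h h' := ⟨h.1.trans h'.1, h.2.trans h'.2⟩
  le_antisymm _ _ h h' := position_injective (h.2.antisymm h'.2)

theorem le_iff {e e' : TightCoord q v} :
    e ≤ e' ↔ e.residue = e'.residue ∧ e.position ≤ e'.position :=
  Iff.rfl

theorem symmGen_le_iff {e e' : TightCoord q v} :
    SymmGen (· ≤ ·) e e' ↔ e.residue = e'.residue :=
  ⟨fun h => h.elim And.left fun h => h.1.symm,
    fun h => (le_total e.position e'.position).imp (⟨h, ·⟩) (⟨h.symm, ·⟩)⟩

theorem base_le_coord_iff (hq : 1 ≤ q) {i : Fin n} :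
    (base : TightCoord q v) ≤ coord i ↔ v i = 0 := by
  grind [le_iff, residue, position]

theorem coord_le_base_iff {i : Fin n} : (coord i : TightCoord q v) ≤ base ↔ v i = q := by
  grind [le_iff, residue, position]

theorem coord_le_coord_iff (hq : 1 ≤ q) {i j : Fin n} :
    (coord i : TightCoord q v) ≤ coord j ↔ (i ≤ j ∧ v i = v j) ∨ (v i = q ∧ v j = 0) := by
  grind [le_iff, residue, position]

open Classical in
/-- The point obtained from `v` by lowering the coordinates in `S` by `1`. Since `base` has to
stay constant, lowering it amounts to raising all other coordinates. -/
noncomputable def lowerAt (S : Set (TightCoord q v)) : Fin n → ℤ :=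
  fun i => v i - (if coord i ∈ S then 1 else 0) + if base ∈ S then 1 else 0

variable {S S' : Set (TightCoord q v)}

theorem lowerAt_empty : lowerAt (∅ : Set (TightCoord q v)) = v := by
  ext i
  simp [lowerAt]

theorem cubeAdj_lowerAt_of_subset (h : S ⊆ S') : CubeAdj (lowerAt S) (lowerAt S') := by
  by_cases hn : base ∈ S ↔ base ∈ S'
  · refine Or.inr ⟨fun i => ?_, fun i => ?_⟩ <;> have := @h (coord i) <;>
      simp only [lowerAt, Pi.add_apply, Pi.one_apply] <;> grind
  · have := @h base
    refine Or.inl ⟨fun i => ?_, fun i => ?_⟩ <;> have := @h (coord i) <;>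
      simp only [lowerAt, Pi.add_apply, Pi.one_apply] <;> grind

theorem symmGen_le_of_lowerAt_mem_Icc
    (h : lowerAt S' ∈ Set.Icc (lowerAt S) (lowerAt S + 1)) : SymmGen (· ≤ ·) S S' := by
  have lower (i) : lowerAt S i ≤ lowerAt S' i := h.1 i
  have upper (i) : lowerAt S' i ≤ lowerAt S i + 1 := h.2 i
  simp only [lowerAt] at lower upper
  by_cases hn : base ∈ S' → base ∈ S
  · refine Or.inr fun e he => ?_
    cases e <;> grind
  · refine Or.inl fun e he => ?_
    cases e <;> grind

theorem cubeAdj_lowerAt_iff : CubeAdj (lowerAt S) (lowerAt S') ↔ SymmGen (· ≤ ·) S S' :=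
  ⟨fun h => h.elim symmGen_le_of_lowerAt_mem_Icc fun h => (symmGen_le_of_lowerAt_mem_Icc h).symm,
    fun h => h.elim cubeAdj_lowerAt_of_subset fun h => symm (cubeAdj_lowerAt_of_subset h)⟩

theorem lowerAt_injOn (q : ℕ) (v : Fin n → ℤ) :
    Set.InjOn (lowerAt (q := q) (v := v)) {Set.univ}ᶜ := by
  intro S hS S' hS' h
  have coords (i : Fin n) := congrFun h i
  simp only [lowerAt] at coords
  have base_mem_iff : base ∈ S ↔ base ∈ S' := by
    obtain ⟨e, he⟩ := (Set.ne_univ_iff_exists_notMem S).mp hS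
    obtain ⟨e', he'⟩ := (Set.ne_univ_iff_exists_notMem S').mp hS'
    cases e <;> cases e' <;> grind
  ext (_ | i)
  · exact base_mem_iff
  · grind

theorem exists_lowerAt_eq (h : CubeAdj v w) (hne : v ≠ w) :
    ∃ S : Set (TightCoord q v), S ≠ Set.univ ∧ lowerAt S = w := by
  obtain ⟨lower, upper⟩ | ⟨lower, upper⟩ := h
  · refine ⟨insert base (coord '' {i | w i = v i}), fun hS => hne ?_, funext fun i => ?_⟩
    · funext i
      exact (by simpa using hS.ge (Set.mem_univ (coord i)) : w i = v i).symm
    · have := lower i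
      have := upper i
      simp only [lowerAt, Pi.add_apply, Pi.one_apply] at *
      grind
  · refine ⟨coord '' {i | w i ≠ v i}, fun hS => ?_, funext fun i => ?_⟩
    · simpa using hS.ge (Set.mem_univ base)
    · have := lower i
      have := upper i
      simp only [lowerAt, Pi.add_apply, Pi.one_apply] at *
      grind

end TightCoord

section Links

open TightCoord

variable {k q : ℕ} {v : Fin (k - 1) → ℤ} {S : Set (TightCoord q v)}

theorem isLowerSet_of_lowerAt_mem_W (hq : 1 ≤ q) (h : lowerAt S ∈ W k q) : IsLowerSet S := by
  obtain ⟨bounds, mono⟩ := h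
  simp only [Monotone, lowerAt] at bounds mono
  rintro (_ | j) (_ | i) hle hj
  · exact hj
  · have := bounds i
    have := coord_le_base_iff.mp hle
    grind
  · have := bounds j
    have := (base_le_coord_iff hq).mp hle
    grind
  · obtain ⟨hij, heq⟩ | ⟨hi, hj⟩ := (coord_le_coord_iff hq).mp hle
    · have := mono hij
      grind
    · have := bounds i
      have := bounds j
      grind

theorem lowerAt_mem_W_of_isLowerSet (hq : 1 ≤ q) (hv : v ∈ W k q) (hS : IsLowerSet S) :
    lowerAt S ∈ W k q := by
  have base_mem {i} (hi : v i = 0) : coord i ∈ S → base ∈ S := hS ((base_le_coord_iff hq).mpr hi)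
  have coord_mem {i} (hi : v i = q) : base ∈ S → coord i ∈ S := hS (coord_le_base_iff.mpr hi)
  refine ⟨fun i => ?_, fun i j hij => ?_⟩ <;> simp only [lowerAt]
  · have := hv.1 i
    grind
  · obtain hlt | heq := (hv.2 hij).lt_or_eq
    · grind
    · have : coord j ∈ S → coord i ∈ S := hS ((coord_le_coord_iff hq).mpr (.inl ⟨hij, heq⟩))
      grind

theorem lowerAt_mem_W_iff (hq : 1 ≤ q) (hv : v ∈ W k q) : lowerAt S ∈ W k q ↔ IsLowerSet S :=
  ⟨isLowerSet_of_lowerAt_mem_W hq, lowerAt_mem_W_of_isLowerSet hq hv⟩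

theorem lowerAt_bijOn_link (hq : 1 ≤ q) (hv : v ∈ W k q) :
    Set.BijOn (lowerAt (q := q) (v := v)) {S | IsLowerSet S ∧ S ≠ ∅ ∧ S ≠ Set.univ}
      {w | w ∈ W k q ∧ w ≠ v ∧ CubeAdj v w} := by
  have inj := lowerAt_injOn q v
  refine ⟨fun S ⟨hS, hne, hne'⟩ => ⟨(lowerAt_mem_W_iff hq hv).mpr hS, fun h => ?_, ?_⟩,
    inj.mono fun S hS => hS.2.2, fun w ⟨hw, hne, hadj⟩ => ?_⟩
  · exact hne (inj hne' Set.empty_ne_univ (h.trans lowerAt_empty.symm))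
  · simpa only [lowerAt_empty] using cubeAdj_lowerAt_of_subset S.empty_subset
  · obtain ⟨S, hS, rfl⟩ := exists_lowerAt_eq (q := q) hadj hne.symm
    refine ⟨S, ⟨(lowerAt_mem_W_iff hq hv).mp hw, ?_, hS⟩, rfl⟩
    rintro rfl
    exact hne lowerAt_empty

theorem link_iso_orderComplex_lowerSet (hk : 1 ≤ k) (hq : 1 ≤ q) (hv : v ∈ W k q) :
    ((T k q).link {v}).Iso (orderComplex (Proper (LowerSet (TightCoord q v)))) := by
  rw [T_eq_cliqueComplex hk hq, link_cliqueComplex hv, cliqueComplex_iso_orderComplex_iff]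
  let lowerSets : Proper (LowerSet (TightCoord q v)) ≃
      {S : Set (TightCoord q v) // IsLowerSet S ∧ S ≠ ∅ ∧ S ≠ Set.univ} :=
    { toFun S :=
        ⟨S.1, S.1.lower, mt LowerSet.coe_eq_empty.mp S.2.1, mt LowerSet.coe_eq_univ.mp S.2.2⟩
      invFun S :=
        ⟨⟨S.1, S.2.1⟩, mt LowerSet.coe_eq_empty.mpr S.2.2.1,
          mt LowerSet.coe_eq_univ.mpr S.2.2.2⟩
      left_inv _ := rfl
      right_inv _ := rfl }
  let e := lowerSets.trans ((lowerAt_bijOn_link hq hv).equiv _)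
  refine ⟨e.symm, fun x y _ => ?_⟩
  obtain ⟨S, rfl⟩ := e.surjective x
  obtain ⟨S', rfl⟩ := e.surjective y
  rw [e.symm_apply_apply, e.symm_apply_apply]
  exact cubeAdj_lowerAt_iff

end Links

section DisjointUnionsOfChains

variable {ι : Type*} {α β : ι → Type*}

/-- A lower set of a disjoint union is a family of lower sets of the summands. -/
def lowerSetSigma [∀ i, LE (α i)] : LowerSet (Σ i, α i) ≃o ∀ i, LowerSet (α i) where
  toFun L i := ⟨Sigma.mk i ⁻¹' L, fun _ _ h => L.lower (Sigma.LE.fiber _ _ _ h)⟩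
  invFun F := ⟨{x | x.2 ∈ F x.1}, by rintro _ _ ⟨i, a, b, h⟩; exact (F i).lower h⟩
  left_inv _ := rfl
  right_inv _ := rfl
  map_rel_iff' := ⟨fun h x hx => h x.1 hx, fun h _ _ hx => h hx⟩

/-- Componentwise order isomorphisms of a product. -/
def orderIsoPi [∀ i, LE (α i)] [∀ i, LE (β i)] (e : ∀ i, α i ≃o β i) :
    (∀ i, α i) ≃o ∀ i, β i where
  toEquiv := Equiv.piCongrRight fun i => (e i).toEquiv
  map_rel_iff' := forall_congr' fun i => (e i).le_iff_le

/-- A lower set of a chain is determined by its cardinality. -/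
noncomputable def lowerSetFin (n : ℕ) : Fin (n + 1) ≃o LowerSet (Fin n) :=
  StrictMono.orderIsoOfSurjective
    (fun t => ⟨{i | i.castSucc < t}, fun _ _ h => (Fin.castSucc_le_castSucc_iff.mpr h).trans_lt⟩)
    (fun s t hst => ⟨fun _ hi => hi.trans hst, fun h => lt_irrefl s
      (@h (s.castLT (by have := t.2; have := Fin.lt_def.mp hst; omega)) hst)⟩)
    fun L => by
      obtain ⟨t, ht, hL⟩ := exists_forall_mem_iff_val_lt L.lower
      exact ⟨⟨t, Nat.lt_succ_of_le ht⟩, SetLike.ext fun i => (hL i).symm⟩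

theorem nonempty_orderIso_fin {E : Type*} [PartialOrder E] [Fintype E] {n : ℕ}
    (h : ∀ x y : E, SymmGen (· ≤ ·) x y) (hn : Fintype.card E = n) : Nonempty (E ≃o Fin n) := by
  classical
  let : LinearOrder E :=
    { (inferInstance : PartialOrder E) with le_total := h, toDecidableLE := Classical.decRel _ }
  exact ⟨(Fintype.orderIsoFinOfCardEq E hn).symm⟩

variable {E : Type*} [PartialOrder E] [Fintype E] [DecidableEq ι] {cls : E → ι} {m : ι → ℕ}

theorem nonempty_orderIso_sigma_fin (h : ∀ x y, SymmGen (· ≤ ·) x y ↔ cls x = cls y)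
    (hm : ∀ c, Fintype.card {x // cls x = c} = m c) : Nonempty (E ≃o Σ c, Fin (m c)) := by
  have fiber (c : ι) : Nonempty ({x // cls x = c} ≃o Fin (m c)) :=
    nonempty_orderIso_fin (fun x y => (h x y).mpr (x.2.trans y.2.symm)) (hm c)
  let fiberIso (c : ι) := (fiber c).some
  let e : (Σ c, Fin (m c)) ≃ E :=
    (Equiv.sigmaCongrRight fun c => (fiberIso c).symm.toEquiv).trans (Equiv.sigmaFiberEquiv cls)
  have cls_e (x) : cls (e x) = x.1 := ((fiberIso x.1).symm x.2).2
  suffices ∀ x y, e x ≤ e y ↔ x ≤ y from ⟨RelIso.symm ⟨e, this _ _⟩⟩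
  refine fun x y => ⟨fun hxy => ?_, ?_⟩
  · obtain ⟨c, a⟩ := x
    obtain ⟨d, b⟩ := y
    obtain rfl : c = d := by simpa only [cls_e] using (h _ _).mp (.inl hxy)
    exact .fiber _ _ _ ((fiberIso c).symm.le_iff_le.mp hxy)
  · rintro ⟨c, a, b, hab⟩
    exact (fiberIso c).symm.monotone hab

theorem nonempty_orderIso_lowerSet_pi_fin (h : ∀ x y, SymmGen (· ≤ ·) x y ↔ cls x = cls y)
    (hm : ∀ c, Fintype.card {x // cls x = c} = m c) :
    Nonempty (LowerSet E ≃o ∀ c, Fin (m c + 1)) := by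
  obtain ⟨e⟩ := nonempty_orderIso_sigma_fin h hm
  exact ⟨(LowerSet.map e).trans
    (lowerSetSigma.trans (orderIsoPi fun c => (lowerSetFin (m c)).symm))⟩

end DisjointUnionsOfChains

section FiberSizes

variable {E α : Type*} [Fintype E]

/-- The classes of the points with equal `f`-value can be numbered such that their cardinalities
are the members of the list `l`. -/
def HasFiberSizes (f : E → α) (l : List ℕ) : Prop :=
  ∃ cls : E → Fin l.length, (∀ x y, cls x = cls y ↔ f x = f y) ∧
    ∀ c, Fintype.card {x // cls x = c} = l.get c

theorem exists_equiv_of_map_univ_eq {β γ : Type*} [Fintype α] [Fintype β] {g : α → γ} {h : β → γ}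
    (hgh : (Finset.univ : Finset α).val.map g = (Finset.univ : Finset β).val.map h) :
    ∃ e : α ≃ β, ∀ a, h (e a) = g a := by
  classical
  have fiber (c : γ) : Nonempty ({a // g a = c} ≃ {b // h b = c}) := by
    rw [← Fintype.card_eq, Fintype.card_subtype, Fintype.card_subtype]
    have count_eq := congrArg (Multiset.count c) hgh
    simp only [Multiset.count_map, eq_comm (a := c)] at count_eq
    exact count_eq
  let fiberEquiv (c : γ) := (fiber c).some
  exact ⟨Equiv.ofFiberEquiv fiberEquiv, Equiv.ofFiberEquiv_map fiberEquiv⟩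

theorem coe_sortedParts {k : ℕ} (p : k.Partition) : (sortedParts p : Multiset ℕ) = p.parts :=
  Multiset.sort_eq _ _

theorem exists_partition_hasFiberSizes (f : E → α) {k : ℕ} (hk : Fintype.card E = k) :
    ∃ p : k.Partition, p.parts.card = Nat.card (Set.range f) ∧
      HasFiberSizes f (sortedParts p) := by
  classical
  let fiberCard (c : Set.range f) : ℕ := Fintype.card {x // Set.rangeFactorization f x = c}
  let p : k.Partition :=
    { parts := (Finset.univ : Finset (Set.range f)).val.map fiberCard
      parts_pos := by
        simp only [Multiset.mem_map, forall_exists_index, and_imp]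
        rintro _ ⟨_, x, rfl⟩ - rfl
        exact Fintype.card_pos_iff.mpr ⟨x, rfl⟩
      parts_sum := by
        rw [← hk, Fintype.card_congr (Equiv.sigmaFiberEquiv (Set.rangeFactorization f)).symm,
          Fintype.card_sigma]
        rfl }
  have parts_eq : (Finset.univ : Finset (Set.range f)).val.map fiberCard =
      (Finset.univ : Finset (Fin (sortedParts p).length)).val.map (sortedParts p).get := by
    rw [Fin.univ_val_map, List.ofFn_get, coe_sortedParts]
  obtain ⟨e, he⟩ := exists_equiv_of_map_univ_eq parts_eq
  refine ⟨p, by simp [p], e ∘ Set.rangeFactorization f, fun x y => ?_, fun c => ?_⟩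
  · exact e.apply_eq_iff_eq.trans Subtype.ext_iff
  · obtain ⟨c, rfl⟩ := e.surjective c
    rw [he]
    exact Fintype.card_congr (Equiv.subtypeEquivRight fun x => e.apply_eq_iff_eq)

theorem monotone_index {n : ℕ} (c : Composition n) : Monotone c.index := by
  intro i j hij
  by_contra! hlt
  exact hij.not_gt (Fin.lt_def.mpr ((c.lt_sizeUpTo_index_succ j).trans_le
    ((c.monotone_sizeUpTo (Nat.succ_le_of_lt hlt)).trans (c.sizeUpTo_index_le i))))

theorem index_zero {n : ℕ} (c : Composition (n + 1)) : (c.index 0 : ℕ) = 0 := by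
  have hlen : 0 < c.length := c.length_pos_iff.mpr n.succ_pos
  have hle := monotone_index c (Fin.zero_le (c.embedding ⟨0, hlen⟩ ⟨0, c.one_le_blocksFun _⟩))
  rw [c.index_embedding] at hle
  exact Nat.le_zero.mp hle

theorem card_fiber_index {n : ℕ} (c : Composition n) (i : Fin c.length) :
    Fintype.card {j // c.index j = i} = c.blocksFun i := by
  rw [← Fintype.card_fin (c.blocksFun i)]
  refine (Fintype.card_congr (Equiv.ofBijective (fun a => ⟨c.embedding i a, c.index_embedding i a⟩)
    ⟨fun a b h => ?_, ?_⟩)).symm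
  · simpa using h
  · rintro ⟨j, rfl⟩
    exact ⟨c.invEmbedding j, Subtype.ext (c.embedding_comp_inv j)⟩

/-- The parts of `p` in decreasing order, as a composition. -/
def sortedComposition {k : ℕ} (p : k.Partition) : Composition k where
  blocks := sortedParts p
  blocks_pos hi := p.parts_pos ((Multiset.mem_sort _).mp hi)
  blocks_sum := by rw [← Multiset.sum_coe, coe_sortedParts, p.parts_sum]

theorem length_sortedComposition {k : ℕ} (p : k.Partition) :
    (sortedComposition p).length = p.parts.card :=
  Multiset.length_sort _

end FiberSizes

section LinkTypes

open TightCoord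

variable {k q : ℕ} {v : Fin (k - 1) → ℤ}

theorem link_iso_K (hk : 1 ≤ k) (hq : 1 ≤ q) (hv : v ∈ W k q) {p : k.Partition}
    (hp : HasFiberSizes (residue : TightCoord q v → ℤ) (sortedParts p)) :
    ((T k q).link {v}).Iso (K p) := by
  obtain ⟨cls, hcls, hcard⟩ := hp
  obtain ⟨e⟩ := nonempty_orderIso_lowerSet_pi_fin
    (fun _ _ => symmGen_le_iff.trans (hcls _ _).symm) hcard
  exact (link_iso_orderComplex_lowerSet hk hq hv).trans (orderComplex_proper_iso e)

theorem exists_mem_W_hasFiberSizes (hk : 1 ≤ k) {p : k.Partition} (hp : p.parts.card ≤ q) :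
    ∃ v ∈ W k q, HasFiberSizes (residue : TightCoord q v → ℤ) (sortedParts p) := by
  obtain ⟨n, rfl⟩ : ∃ n, k = n + 1 := ⟨k - 1, by omega⟩
  let c := sortedComposition p
  have index_lt (j) : ((c.index j : ℕ) : ℤ) < q := by
    have := (c.index j).2
    have : c.length = p.parts.card := length_sortedComposition p
    omega
  let v : Fin n → ℤ := fun i => (c.index i.succ : ℕ)
  have residue_eq (e : TightCoord q v) : e.residue = (c.index (equivFin q v e) : ℕ) := by
    rcases e with _ | i
    · exact congrArg Nat.cast (index_zero c).symm
    · exact if_neg (index_lt i.succ).ne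
  refine ⟨v, ⟨fun i => ⟨Int.natCast_nonneg _, (index_lt _).le⟩, fun i j hij => ?_⟩,
    c.index ∘ equivFin q v, fun x y => ?_, fun i : Fin c.length => ?_⟩
  · exact Int.ofNat_le.mpr (monotone_index c (Fin.succ_le_succ_iff.mpr hij))
  · rw [residue_eq, residue_eq, Nat.cast_inj, Fin.val_inj]
    rfl
  · exact (Fintype.card_congr ((equivFin q v).subtypeEquiv fun _ => Iff.rfl)).trans
      (card_fiber_index c i)

theorem exists_partition_hasFiberSizes_residue (hk : 1 ≤ k) (hq : 1 ≤ q)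
    (hv : v ∈ W k q) :
    ∃ p : k.Partition, p.parts.card ≤ q ∧
      HasFiberSizes (residue : TightCoord q v → ℤ) (sortedParts p) := by
  obtain ⟨p, hp, hsizes⟩ := exists_partition_hasFiberSizes (residue : TightCoord q v → ℤ)
    (show Fintype.card _ = k by rw [card_tightCoord]; omega)
  refine ⟨p, hp.trans_le ?_, hsizes⟩
  have range_subset : Set.range (residue : TightCoord q v → ℤ) ⊆ Set.Ico 0 (q : ℤ) := by
    rintro _ ⟨_ | i, rfl⟩
    · exact ⟨le_rfl, Int.natCast_pos.mpr hq⟩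
    · have := hv.1 i
      grind [residue]
  calc Nat.card (Set.range residue) ≤ (Set.Ico 0 (q : ℤ)).ncard := Set.ncard_le_ncard range_subset
    _ = q := by
      rw [← Finset.coe_Ico, Set.ncard_coe_finset, Int.card_Ico, sub_zero, Int.toNat_natCast]

end LinkTypes

section Multichains

variable {P Q : Type*} [PartialOrder P] [PartialOrder Q]

/-- The multisets of `n` pairwise comparable elements. Unlike for monotone maps `Fin n →o P`, only
comparability in `P` matters. -/
abbrev ChainSym (P : Type*) [PartialOrder P] (n : ℕ) : Type _ :=
  {s : Sym P n // ∀ x ∈ s, ∀ y ∈ s, SymmGen (· ≤ ·) x y}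

theorem exists_pairwise_le_coe_eq {s : Multiset P} (hs : ∀ x ∈ s, ∀ y ∈ s, SymmGen (· ≤ ·) x y) :
    ∃ l : List P, l.Pairwise (· ≤ ·) ∧ (l : Multiset P) = s := by
  classical
  let r : P → P → Prop := fun x y => toLinearExtension x ≤ toLinearExtension y
  have inj : Function.Injective (toLinearExtension : P → LinearExtension P) := fun _ _ h => h
  have : IsTrans P r := ⟨fun _ _ _ => le_trans⟩
  have : Std.Antisymm r := ⟨fun _ _ h h' => inj (le_antisymm h h')⟩
  have : Std.Total r := ⟨fun _ _ => le_total _ _⟩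
  refine ⟨s.sort r, (s.pairwise_sort r).imp_of_mem fun {a b} ha hb hab => ?_, s.sort_eq r⟩
  rw [Multiset.mem_sort] at ha hb
  obtain h | h := hs a ha b hb
  · exact h
  · exact (antisymm (r := r) hab (toLinearExtension.monotone h)).le

theorem card_orderHom_fin_eq_card_chainSym (P : Type*) [PartialOrder P] (n : ℕ) :
    Nat.card (Fin n →o P) = Nat.card (ChainSym P n) := by
  let values (g : Fin n →o P) : ChainSym P n := ⟨⟨List.ofFn g, List.length_ofFn⟩, by
    intro x hx y hy
    obtain ⟨i, rfl⟩ := List.mem_ofFn.mp hx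
    obtain ⟨j, rfl⟩ := List.mem_ofFn.mp hy
    exact (le_total i j).imp (g.monotone ·) (g.monotone ·)⟩
  refine Nat.card_congr (Equiv.ofBijective values ⟨fun g g' h => ?_, fun s => ?_⟩)
  · have sorted (g : Fin n →o P) : (List.ofFn g).Pairwise (· ≤ ·) :=
      List.pairwise_ofFn.mpr fun i j hij => g.monotone hij.le
    have perm : (List.ofFn g).Perm (List.ofFn g') :=
      Multiset.coe_eq_coe.mp (congrArg (fun s : ChainSym P n => (s.1 : Multiset P)) h)
    exact OrderHom.ext _ _ (List.ofFn_injective (perm.eq_of_pairwise' (sorted g) (sorted g')))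
  · obtain ⟨⟨s, hs⟩, hchain⟩ := s
    obtain ⟨l, hl, rfl⟩ := exists_pairwise_le_coe_eq hchain
    obtain rfl : l.length = n := hs
    refine ⟨⟨l.get, hl.sortedLE.monotone_get⟩, Subtype.ext (Subtype.ext ?_)⟩
    exact congrArg (fun l : List P => (l : Multiset P)) (List.ofFn_get l)

theorem card_orderHom_fin_congr (e : P ≃ Q)
    (he : ∀ x y, SymmGen (· ≤ ·) x y ↔ SymmGen (· ≤ ·) (e x) (e y)) (n : ℕ) :
    Nat.card (Fin n →o P) = Nat.card (Fin n →o Q) := by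
  rw [card_orderHom_fin_eq_card_chainSym, card_orderHom_fin_eq_card_chainSym]
  refine Nat.card_congr ((Sym.equivCongr e).subtypeEquiv fun s => ?_)
  change _ ↔ ∀ x ∈ Sym.map e s, ∀ y ∈ Sym.map e s, _
  simp only [Sym.mem_map, forall_exists_index, and_imp, forall_apply_eq_imp_iff₂, he]

theorem card_orderHom_fin_fin (n m : ℕ) : Nat.card (Fin n →o Fin (m + 1)) = (m + n).choose n := by
  have all_comparable (s : Sym (Fin (m + 1)) n) : ∀ x ∈ s, ∀ y ∈ s, SymmGen (· ≤ ·) x y :=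
    fun x _ y _ => le_total x y
  rw [card_orderHom_fin_eq_card_chainSym, Nat.card_congr (Equiv.subtypeUnivEquiv all_comparable),
    Sym.natCard_sym_eq_choose, Nat.card_fin]
  congr 1
  omega

theorem card_orderHom_fin_productOfChains (n : ℕ) (l : List ℕ) :
    Nat.card (Fin n →o ProductOfChains l) =
      ((l : Multiset ℕ).map fun m => (m + n).choose n).prod := by
  simp only [Nat.card_congr OrderHom.piIso.toEquiv, Nat.card_pi, card_orderHom_fin_fin]
  rw [Multiset.map_coe, Multiset.prod_coe, ← List.prod_ofFn]
  nth_rw 4 [← List.ofFn_get l]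
  rw [List.map_ofFn]
  rfl

theorem symmGen_le_of_not_proper [BoundedOrder P] {x : P} (hx : ¬(x ≠ ⊥ ∧ x ≠ ⊤)) (y : P) :
    SymmGen (· ≤ ·) x y := by
  by_cases hbot : x = ⊥
  · exact Or.inl (hbot ▸ bot_le)
  · exact Or.inr ((not_not.mp (not_and.mp hx hbot)).symm ▸ le_top)

theorem card_not_proper (P : Type*) [PartialOrder P] [BoundedOrder P] [Nontrivial P] :
    Nat.card {x : P // ¬(x ≠ ⊥ ∧ x ≠ ⊤)} = 2 := by
  rw [← Set.ncard_pair (bot_ne_top (α := P)), ← Nat.card_coe_set_eq]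
  refine Nat.card_congr (Equiv.subtypeEquivRight fun x => ?_)
  rw [not_and_or, not_not, not_not, Set.mem_insert_iff, Set.mem_singleton_iff]

theorem exists_equiv_of_proper_equiv [BoundedOrder P] [BoundedOrder Q] [Nontrivial P]
    [Nontrivial Q] (e : Proper P ≃ Proper Q)
    (he : ∀ x y, SymmGen (· ≤ ·) x y ↔ SymmGen (· ≤ ·) (e x) (e y)) :
    ∃ e : P ≃ Q, ∀ x y, SymmGen (· ≤ ·) x y ↔ SymmGen (· ≤ ·) (e x) (e y) := by
  classical
  have : Finite {x : P // ¬(x ≠ ⊥ ∧ x ≠ ⊤)} :=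
    Nat.finite_of_card_ne_zero (by rw [card_not_proper]; decide)
  have : Finite {x : Q // ¬(x ≠ ⊥ ∧ x ≠ ⊤)} :=
    Nat.finite_of_card_ne_zero (by rw [card_not_proper]; decide)
  obtain ⟨d⟩ := Finite.card_eq.mp ((card_not_proper P).trans (card_not_proper Q).symm)
  refine ⟨(Equiv.sumCompl _).symm.trans ((Equiv.sumCongr e d).trans (Equiv.sumCompl _)),
    fun x y => ?_⟩
  obtain ⟨x, rfl⟩ := (Equiv.sumCompl fun x : P => x ≠ ⊥ ∧ x ≠ ⊤).surjective x
  obtain ⟨y, rfl⟩ := (Equiv.sumCompl fun x : P => x ≠ ⊥ ∧ x ≠ ⊤).surjective y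
  simp only [Equiv.trans_apply, Equiv.symm_apply_apply]
  rcases x with x | x
  · rcases y with y | y
    · exact he x y
    · exact iff_of_true (symmGen_le_of_not_proper y.2 _).symm
        (symmGen_le_of_not_proper (d y).2 _).symm
  · exact iff_of_true (symmGen_le_of_not_proper x.2 _) (symmGen_le_of_not_proper (d x).2 _)

end Multichains

section ProductsOfBinomials

theorem eq_of_forall_prod_map_add_eq {s t : Multiset ℕ}
    (h : ∀ n, (s.map fun m => m + (n + 1)).prod = (t.map fun m => m + (n + 1)).prod) : s = t := by
  open Polynomial in
  let poly (s : Multiset ℕ) : ℤ[X] := ((s.map fun m : ℕ => -(m : ℤ)).map fun a => X - C a).prod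
  have eval_poly (s : Multiset ℕ) (n : ℕ) :
      (poly s).eval ((n : ℤ) + 1) = ((s.map fun m => m + (n + 1)).prod : ℕ) := by
    simp only [poly, Polynomial.eval_multiset_prod, Multiset.map_map, Function.comp_apply,
      Polynomial.eval_sub, Polynomial.eval_X, Polynomial.eval_C, sub_neg_eq_add,
      Nat.cast_multiset_prod, Nat.cast_add, Nat.cast_one, add_comm]
  have poly_eq : poly s = poly t := by
    refine Polynomial.eq_of_infinite_eval_eq _ _ ((Set.infinite_range_of_injective
      (f := fun n : ℕ => (n : ℤ) + 1) fun a b hab => by simpa using hab).mono ?_)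
    rintro _ ⟨n, rfl⟩
    exact (eval_poly s n).trans ((congrArg Nat.cast (h n)).trans (eval_poly t n).symm)
  have roots_eq := congrArg Polynomial.roots poly_eq
  rw [Polynomial.roots_multiset_prod_X_sub_C, Polynomial.roots_multiset_prod_X_sub_C] at roots_eq
  exact Multiset.map_injective (neg_injective.comp Nat.cast_injective) roots_eq

theorem prod_map_choose_succ (s : Multiset ℕ) (n : ℕ) :
    (s.map fun m => (m + (n + 1)).choose (n + 1)).prod * (n + 1) ^ s.card =
      (s.map fun m => (m + n).choose n).prod * (s.map fun m => m + (n + 1)).prod := by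
  rw [← Multiset.prod_map_mul, ← Multiset.prod_replicate, ← Multiset.map_const,
    ← Multiset.prod_map_mul]
  refine congrArg Multiset.prod (Multiset.map_congr rfl fun m _ => ?_)
  exact (Nat.add_one_mul_choose_eq (m + n) n).symm.trans (mul_comm _ _)

theorem eq_of_forall_prod_map_choose_eq {s t : Multiset ℕ} (hs : ∀ m ∈ s, 0 < m)
    (ht : ∀ m ∈ t, 0 < m) (h : ∀ n, (s.map fun m => (m + n).choose n).prod =
      (t.map fun m => (m + n).choose n).prod) : s = t := by
  -- The powers of `n + 1` in `prod_map_choose_succ` are factors `m + (n + 1)` with `m = 0`.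
  have padded_eq : s + .replicate t.card 0 = t + .replicate s.card 0 := by
    refine eq_of_forall_prod_map_add_eq fun n => ?_
    have choose_pos : 0 < (t.map fun m => (m + n).choose n).prod := by
      refine Nat.pos_of_ne_zero (Multiset.prod_ne_zero fun hzero => ?_)
      obtain ⟨m, -, hm⟩ := Multiset.mem_map.mp hzero
      exact (Nat.choose_pos (Nat.le_add_left n m)).ne' hm
    have succ_s := prod_map_choose_succ s n
    have succ_t := prod_map_choose_succ t n
    rw [h, h] at succ_s
    simp only [Multiset.map_add, Multiset.prod_add, Multiset.map_replicate, Multiset.prod_replicate,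
      zero_add]
    refine Nat.eq_of_mul_eq_mul_left choose_pos ?_
    rw [← mul_assoc, ← mul_assoc, ← succ_s, ← succ_t]
    ring
  have filter_padded {u : Multiset ℕ} (hu : ∀ m ∈ u, 0 < m) (n : ℕ) :
      (u + .replicate n 0).filter (0 < ·) = u := by
    rw [Multiset.filter_add, Multiset.filter_eq_self.mpr hu, Multiset.filter_eq_nil.mpr, add_zero]
    exact fun m hm => (Multiset.eq_of_mem_replicate hm).not_gt
  rw [← filter_padded hs t.card, padded_eq, filter_padded ht]

end ProductsOfBinomials

section PartitionOfK

theorem nontrivial_productOfChains {k : ℕ} (hk : 1 ≤ k) (p : k.Partition) :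
    Nontrivial (ProductOfChains (sortedParts p)) := by
  let c := sortedComposition p
  let i : Fin c.length := ⟨0, c.length_pos_iff.mpr hk⟩
  have : Nontrivial (Fin (c.blocksFun i + 1)) :=
    Fin.nontrivial_iff_two_le.mpr (Nat.succ_le_succ (c.one_le_blocksFun i))
  exact Pi.nontrivial_at (f := fun i => Fin (c.blocksFun i + 1)) i

theorem partition_eq_of_K_iso {k : ℕ} (hk : 1 ≤ k) {p p' : k.Partition} (h : (K p).Iso (K p')) :
    p = p' := by
  have := nontrivial_productOfChains hk p
  have := nontrivial_productOfChains hk p'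
  obtain ⟨e₀, he₀⟩ := orderComplex_iso_iff.mp h
  obtain ⟨e, he⟩ := exists_equiv_of_proper_equiv e₀ he₀
  refine Nat.Partition.ext (eq_of_forall_prod_map_choose_eq (fun _ => p.parts_pos)
    (fun _ => p'.parts_pos) fun n => ?_)
  have card_eq := card_orderHom_fin_congr e he n
  rwa [card_orderHom_fin_productOfChains, card_orderHom_fin_productOfChains, coe_sortedParts,
    coe_sortedParts] at card_eq

end PartitionOfK

section Counting

variable {k q : ℕ}

theorem exists_link_iso_K_of_mem_W (hk : 1 ≤ k) (hq : 1 ≤ q) {v : Fin (k - 1) → ℤ}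
    (hv : v ∈ W k q) :
    ∃ p : k.Partition, p.parts.card ≤ q ∧ ((T k q).link {v}).Iso (K p) := by
  obtain ⟨p, hp, hsizes⟩ := exists_partition_hasFiberSizes_residue hk hq hv
  exact ⟨p, hp, link_iso_K hk hq hv hsizes⟩

theorem exists_mem_W_link_iso_K (hk : 1 ≤ k) (hq : 1 ≤ q) {p : k.Partition}
    (hp : p.parts.card ≤ q) : ∃ v ∈ W k q, ((T k q).link {v}).Iso (K p) := by
  obtain ⟨v, hv, hsizes⟩ := exists_mem_W_hasFiberSizes hk hp
  exact ⟨v, hv, link_iso_K hk hq hv hsizes⟩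

theorem one_le_card_parts (hk : 1 ≤ k) (p : k.Partition) : 1 ≤ p.parts.card :=
  length_sortedComposition p ▸ (sortedComposition p).length_pos_iff.mpr hk

theorem card_parts_le (p : k.Partition) : p.parts.card ≤ k :=
  length_sortedComposition p ▸ (sortedComposition p).length_le

theorem numLinkTypes_eq (hk : 1 ≤ k) (hq : 1 ≤ q) :
    numLinkTypes k q = {p : k.Partition | p.parts.card ≤ q}.ncard := by
  choose v hv hiso using fun p : {p : k.Partition // p.parts.card ≤ q} =>
    exists_mem_W_link_iso_K hk hq p.2
  rw [numLinkTypes, vertices_T hk hq]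
  symm
  refine Set.ncard_congr (fun p hp => Quotient.mk _ ((T k q).link {v ⟨p, hp⟩})) ?_ ?_ ?_
  · exact fun p hp => ⟨_, hv ⟨p, hp⟩, rfl⟩
  · intro p p' hp hp' h
    exact partition_eq_of_K_iso hk
      ((hiso ⟨p, hp⟩).symm.trans ((Quotient.exact h).trans (hiso ⟨p', hp'⟩)))
  · rintro _ ⟨w, hw, rfl⟩
    obtain ⟨p, hp, h⟩ := exists_link_iso_K_of_mem_W hk hq hw
    exact ⟨p, hp, Quotient.sound ((hiso ⟨p, hp⟩).trans h.symm)⟩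

theorem ncard_card_parts_le (hk : 1 ≤ k) (q : ℕ) :
    {p : k.Partition | p.parts.card ≤ q}.ncard = ∑ s ∈ Finset.Icc 1 q, (Par k s).ncard := by
  have eq_biUnion : {p : k.Partition | p.parts.card ≤ q} =
      ⋃ s ∈ (Finset.Icc 1 q : Set ℕ), Par k s := by
    ext p
    have := one_le_card_parts hk p
    simp [Par, this]
  have disjoint_par : (Finset.Icc 1 q : Set ℕ).PairwiseDisjoint (Par k) := fun _ _ _ _ hst =>
    Set.disjoint_left.mpr fun _ hs ht => hst (hs.symm.trans ht)
  rw [eq_biUnion, (Finset.finite_toSet _).ncard_biUnion (fun _ _ => Set.toFinite _) disjoint_par,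
    finsum_mem_coe_finset]

end Counting

end EdgewiseSubdivision

theorem mainTheorem6 (k q : ℕ) (hk : 1 ≤ k) (hq : 1 ≤ q) :
    (∀ v ∈ (EdgewiseSubdivision.T k q).vertices,
      ∃ s ∈ Finset.Icc 1 q, ∃ p ∈ EdgewiseSubdivision.Par k s,
        ((EdgewiseSubdivision.T k q).link {v}).Iso (EdgewiseSubdivision.K p)) ∧
    (∀ s ∈ Finset.Icc 1 q, ∀ p ∈ EdgewiseSubdivision.Par k s,
      ∃ v ∈ (EdgewiseSubdivision.T k q).vertices,
        ((EdgewiseSubdivision.T k q).link {v}).Iso (EdgewiseSubdivision.K p)) ∧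
    (k ≤ q → EdgewiseSubdivision.numLinkTypes k q = Nat.card k.Partition) ∧
    (q < k → EdgewiseSubdivision.numLinkTypes k q =
      ∑ s ∈ Finset.Icc 1 q, (EdgewiseSubdivision.Par k s).ncard) := by
  open EdgewiseSubdivision in
  rw [vertices_T hk hq, numLinkTypes_eq hk hq]
  refine ⟨fun v hv => ?_, fun s hs p hp => ?_, fun h => ?_, fun _ => ncard_card_parts_le hk q⟩
  · obtain ⟨p, hp, h⟩ := exists_link_iso_K_of_mem_W hk hq hv
    exact ⟨_, Finset.mem_Icc.mpr ⟨one_le_card_parts hk p, hp⟩, p, rfl, h⟩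
  · exact exists_mem_W_link_iso_K hk hq (hp.trans_le (Finset.mem_Icc.mp hs).2)
  · have all : {p : k.Partition | p.parts.card ≤ q} = Set.univ :=
      Set.eq_univ_of_forall fun p => (card_parts_le p).trans h
    rw [all, Set.ncard_univ]
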